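/- Cops and Robbers is played on a finite graph or digraph by $m$ cops and one robber: first the cops choose their vertices, then the robber chooses his; afterwards, in each round, every cop moves along an edge (in a digraph, along an arc in its direction) or stays put, and then the robber does likewise. The cops win if after finitely many rounds some cop is on the robber's vertex. The cop number $\mathrm{cop}(\cdot)$ is the least $m$ such that $m$ cops can guarantee to win. A Steiner triple system on a finite set $V$ is a family of $3$-element subsets (triples) of $V$ such that any two distinct points lie in exactly one triple. An oriented Steiner triple graph is a tournament on $V$ obtained from a Steiner triple system on $V$ by orienting each triple $\{a,b,c\}$ as a directed $3$-cycle, in either of the two ways. (1) For every $k\in\mathbb{N}$ there exists an oriented Steiner triple graph $T$ with $\mathrm{cop}(T)\ge k$. (2) The underlying graph of every oriented Steiner triple graph on $n\ge 1$ vertices is the complete graph, which has cop number $1$. (3) For every $k\in\mathbb{N}$ there exists a strongly connected oriented graph $D$ (a digraph without loops and with at most one arc between any two vertices) such that $\mathrm{cop}(D)-\mathrm{cop}(G)>k$, where $G$ is the underlying undirected graph of $D$; moreover $D$ can be chosen with $G$ complete. -/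

import Mathlib

namespace CopsRobbers

/-! ### The game

The game is played on a vertex set `V` along a relation `adj`; for an undirected graph `adj` is
adjacency, for a directed graph `adj u v` says that there is an arc from `u` to `v`. -/

/-- In one turn an agent moves along an edge (or an arc, in its direction) or stays put. -/
def Step {V : Type*} (adj : V → V → Prop) (u v : V) : Prop := u = v ∨ adj u v

/-- The robber's first `t` positions `r 0, …, r (t - 1)`, most recent one first. -/
def history {V : Type*} (r : ℕ → V) : ℕ → List V
  | 0 => []
  | t + 1 => r t :: history r t

/-- A strategy for `k` cops: a function from what the robber has done so far (most recent
position first) to the positions of the cops, `pos []` being the initial placement. After the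
robber has taken up a new position `v`, each cop makes one step. -/
structure CopStrategy {V : Type*} (adj : V → V → Prop) (k : ℕ) where
  pos : List V → Fin k → V
  legal : ∀ (h : List V) (v : V) (i : Fin k), Step adj (pos h i) (pos (v :: h) i)

/-- The strategy wins if, however the robber chooses his first position `r 0` and his later
moves, he is caught after finitely many rounds: either he takes up a position `r t` where a cop
stands, or a cop moves to his position `r t` in the turn that follows. -/
def CopStrategy.Wins {V : Type*} {adj : V → V → Prop} {k : ℕ} (σ : CopStrategy adj k) : Prop :=
  ∀ r : ℕ → V, (∀ t, Step adj (r t) (r (t + 1))) →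
    ∃ (t : ℕ) (i : Fin k), σ.pos (history r t) i = r t ∨ σ.pos (history r (t + 1)) i = r t

/-- `k` cops can guarantee to win. -/
def CopsWin {V : Type*} (adj : V → V → Prop) (k : ℕ) : Prop :=
  ∃ σ : CopStrategy adj k, σ.Wins

/-- On a finite vertex set, one cop per vertex wins, so the set of which the cop number is the
minimum is not empty. -/
theorem copsWin_card {V : Type*} [Finite V] (adj : V → V → Prop) : CopsWin adj (Nat.card V) :=
  ⟨⟨fun _ i => (Finite.equivFin V).symm i, fun _ _ _ => Or.inl rfl⟩,
    fun r _ => ⟨0, Finite.equivFin V (r 0), Or.inl (by simp)⟩⟩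

/-- The fewest number of cops that can guarantee to win (used for finite `V` only). -/
noncomputable def copNumber {V : Type*} (adj : V → V → Prop) : ℕ :=
  sInf {k : ℕ | CopsWin adj k}

/-- The cop number of an undirected graph. -/
noncomputable def graphCop {V : Type*} (G : SimpleGraph V) : ℕ := copNumber G.Adj

/-- The cop number of a directed graph. -/
noncomputable def digraphCop {V : Type*} (D : Digraph V) : ℕ := copNumber D.Adj

/-! ### Oriented graphs and Steiner triple graphs -/

/-- An oriented graph: no loops, and at most one arc between any two vertices. -/
def IsOriented {V : Type*} (D : Digraph V) : Prop :=
  (∀ u, ¬ D.Adj u u) ∧ ∀ u v, D.Adj u v → ¬ D.Adj v u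

/-- The underlying undirected graph. -/
def underlying {V : Type*} (D : Digraph V) : SimpleGraph V := D.toSimpleGraphInclusive

/-- From every vertex there is a directed path to every vertex. -/
def StronglyConnected {V : Type*} (D : Digraph V) : Prop :=
  ∀ u v, Relation.ReflTransGen D.Adj u v

/-- A Steiner triple system on `V`: a family of 3-element subsets such that any two distinct
points lie in exactly one of them. -/
structure SteinerTripleSystem (V : Type*) where
  triples : Set (Finset V)
  card_eq_three : ∀ B ∈ triples, B.card = 3
  unique_triple : ∀ x y : V, x ≠ y → ∃! B : Finset V, B ∈ triples ∧ x ∈ B ∧ y ∈ B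

/-- `D` arises from the Steiner triple system `S` by orienting each triple cyclically: `D` is an
oriented graph in which the arcs inside each triple are those of a directed 3-cycle `a → b → c → a`
on it. (Any two distinct vertices lie in a triple, so there are no other arcs.) -/
def IsCyclicOrientation {V : Type*} (S : SteinerTripleSystem V) (D : Digraph V) : Prop :=
  IsOriented D ∧
    ∀ B ∈ S.triples, ∃ a b c : V, a ≠ b ∧ b ≠ c ∧ c ≠ a ∧ (∀ x, x ∈ B ↔ x = a ∨ x = b ∨ x = c) ∧
      D.Adj a b ∧ D.Adj b c ∧ D.Adj c a

/-- An oriented Steiner triple graph. -/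
def IsSteinerTripleGraph {V : Type*} (D : Digraph V) : Prop :=
  ∃ S : SteinerTripleSystem V, IsCyclicOrientation S D

end CopsRobbers

namespace CopsRobbers

/-! ### The robber's side of the game -/

/-! The construction is probabilistic. Take the lines of affine space over `ZMod 3` as triples and
orient them independently at random. Fix the robber at `v` and `m` cops. A vertex `u` is a good
escape when at most `m + 1` triples through `u` have prescribed orientations. Candidates `u` can be
spread out so that these sets of triples are disjoint (`exists_scattered`), so `N` candidates all
fail with probability at most `(1 - 2^-(m+1))^N`. With `N = 2^d` among `3^d` points this beats the
number `3^(d(m+1))` of positions, so some orientation is `Evasive`. In an evasive oriented graph the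
robber always has an arc towards every cop. No arc goes back, so no cop can reach him. The
underlying graph is complete, where one cop wins at once. -/

/-- Wherever the robber is and wherever `m` cops are, the robber has a move along an arc to a vertex
that dominates all cops not standing on his own vertex. -/
def Evasive {V : Type*} (adj : V → V → Prop) (m : ℕ) : Prop :=
  ∀ (v : V) (g : Fin m → V), ∃ u, adj v u ∧ ∀ i, g i ≠ v → adj u (g i)

/-- The history of the robber's path when `next` chooses each position from the previous ones. -/
def pathHistory {V : Type*} (next : List V → V) : ℕ → List V
  | 0 => []
  | t + 1 => next (pathHistory next t) :: pathHistory next t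

theorem history_pathHistory {V : Type*} (next : List V → V) (t : ℕ) :
    history (fun t => next (pathHistory next t)) t = pathHistory next t := by
  induction t with
  | zero => rfl
  | succ t ih => simp only [history, pathHistory, ih]

theorem Evasive.exists_escape {V : Type*} {adj : V → V → Prop} {m k : ℕ} (h : Evasive adj m)
    (hk : k ≤ m) (v : V) (c : Fin k → V) (hc : ∀ i, c i ≠ v) :
    ∃ u, adj v u ∧ ∀ i, adj u (c i) := by
  -- Surplus cops are placed on `v`, where `Evasive` demands nothing of them.
  obtain ⟨u, hu, hg⟩ := h v (fun i => if hi : i.1 < k then c ⟨i, hi⟩ else v)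
  refine ⟨u, hu, fun i => ?_⟩
  have := hg ⟨i, i.2.trans_le hk⟩
  simp only [Fin.is_lt, dite_true] at this
  exact this (hc i)

/-- Invariant: after each robber move there is an arc from him to every cop, so the next cop move
cannot catch him, and evasiveness restores the invariant. -/
theorem Evasive.not_copsWin {V : Type*} [Finite V] {D : Digraph V} {m k : ℕ}
    (hD : IsOriented D) (h : Evasive D.Adj m) (hm : m < Nat.card V) (hk : k ≤ m) :
    ¬ CopsWin D.Adj k := by
  classical
  rintro ⟨σ, hσ⟩
  have hesc := h.exists_escape hk
  -- The robber starts as if escaping from a free vertex `v₀`; this establishes the invariant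
  -- initially.
  obtain ⟨v₀, hv₀⟩ : ∃ v, ∀ i, σ.pos [] i ≠ v := by
    by_contra! hcon
    have := Nat.card_le_card_of_surjective (σ.pos []) hcon
    simp only [Nat.card_eq_fintype_card, Fintype.card_fin] at this
    omega
  obtain ⟨u₀, -, hu₀⟩ := hesc v₀ _ hv₀
  have hmove : ∀ (v : V) (c : Fin k → V), ∃ u, (∀ i, c i ≠ v) →
      D.Adj v u ∧ ∀ i, D.Adj u (c i) := fun v c => by
    by_cases hc : ∀ i, c i ≠ v
    · obtain ⟨u, hu⟩ := hesc v c hc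
      exact ⟨u, fun _ => hu⟩
    · exact ⟨v, fun h => absurd h hc⟩
  choose F hF using hmove
  let next : List V → V := fun l => match l with
    | [] => u₀
    | v :: l => F v (σ.pos (v :: l))
  have hsafe : ∀ (l : List V) (u : V), (∀ i, D.Adj u (σ.pos l i)) →
      (∀ i, σ.pos l i ≠ u) ∧ ∀ i, σ.pos (u :: l) i ≠ u := by
    refine fun l u hu => ⟨fun i hi => hD.1 u (by simpa [hi] using hu i), fun i hi => ?_⟩
    rcases σ.legal l u i with hs | hs
    · exact hD.1 u (by simpa [hs, hi] using hu i)
    · exact hD.2 _ _ (hu i) (hi ▸ hs)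
  have key : ∀ t i, D.Adj (next (pathHistory next t)) (σ.pos (pathHistory next t) i) := by
    intro t
    induction t with
    | zero => exact hu₀
    | succ t ih => exact (hF _ _ (hsafe _ _ ih).2).2
  obtain ⟨t, i, hi⟩ := hσ (fun t => next (pathHistory next t)) fun t =>
    Or.inr (hF _ _ (hsafe _ _ (key t)).2).1
  rw [history_pathHistory, history_pathHistory] at hi
  rcases hi with hi | hi
  · exact (hsafe _ _ (key t)).1 i hi
  · exact (hsafe _ _ (key t)).2 i hi

theorem Evasive.lt_digraphCop {V : Type*} [Finite V] {D : Digraph V} {m : ℕ}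
    (hD : IsOriented D) (h : Evasive D.Adj m) (hm : m < Nat.card V) : m < digraphCop D := by
  by_contra! hlt
  exact h.not_copsWin hD hm hlt (Nat.sInf_mem (s := {k | CopsWin D.Adj k}) ⟨_, copsWin_card _⟩)

/-! ### Complete graphs and Steiner triple graphs -/

theorem graphCop_top {V : Type*} [Nonempty V] : graphCop (⊤ : SimpleGraph V) = 1 := by
  obtain ⟨v₀⟩ := ‹Nonempty V›
  have h1 : CopsWin (⊤ : SimpleGraph V).Adj 1 := by
    -- The cop jumps to the robber's latest position; `v₀` is only the initial placement.
    refine ⟨⟨fun l _ => l.headD v₀, fun l v _ => ?_⟩, fun r _ => ⟨0, 0, Or.inr rfl⟩⟩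
    simp only [List.headD_cons, Step, SimpleGraph.top_adj]
    exact em _
  have h0 : ¬ CopsWin (⊤ : SimpleGraph V).Adj 0 := by
    rintro ⟨σ, hσ⟩
    obtain ⟨-, i, -⟩ := hσ (fun _ => v₀) fun _ => Or.inl rfl
    exact i.elim0
  refine le_antisymm (Nat.sInf_le h1) (Nat.one_le_iff_ne_zero.2 fun h => h0 ?_)
  have := Nat.sInf_mem (s := {k | CopsWin (⊤ : SimpleGraph V).Adj k}) ⟨1, h1⟩
  rwa [show sInf {k | CopsWin (⊤ : SimpleGraph V).Adj k} = 0 from h] at this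

theorem IsSteinerTripleGraph.exists_cycle {V : Type*} {D : Digraph V}
    (h : IsSteinerTripleGraph D) {x y : V} (hxy : x ≠ y) :
    D.Adj x y ∨ (D.Adj y x ∧ ∃ z, D.Adj x z ∧ D.Adj z y) := by
  obtain ⟨S, -, hS⟩ := h
  obtain ⟨B, ⟨hB, hx, hy⟩, -⟩ := S.unique_triple x y hxy
  obtain ⟨a, b, c, -, -, -, hmem, hab, hbc, hca⟩ := hS B hB
  rw [hmem] at hx hy
  rcases hx with rfl | rfl | rfl <;> rcases hy with rfl | rfl | rfl <;> grind

theorem IsSteinerTripleGraph.underlying_eq_top {V : Type*} {D : Digraph V}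
    (h : IsSteinerTripleGraph D) : underlying D = ⊤ := by
  ext x y
  simp only [underlying, Digraph.toSimpleGraphInclusive, SimpleGraph.fromRel_adj,
    SimpleGraph.top_adj, and_iff_left_iff_imp]
  exact fun hxy => (h.exists_cycle hxy).imp_right And.left

theorem IsSteinerTripleGraph.stronglyConnected {V : Type*} {D : Digraph V}
    (h : IsSteinerTripleGraph D) : StronglyConnected D := by
  intro x y
  rcases eq_or_ne x y with rfl | hxy
  · exact .refl
  rcases h.exists_cycle hxy with hxy | ⟨-, z, hxz, hzy⟩
  · exact .single hxy
  · exact (Relation.ReflTransGen.single hxz).tail hzy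

/-! ### Steiner quasigroups and orientations of their triples -/

/-- `t` is the operation of a Steiner quasigroup: for `x ≠ y`, `t x y` is the third point on the
triple through `x` and `y`. -/
structure IsSteinerQuasigroup {X : Type*} (t : X → X → X) : Prop where
  comm : ∀ x y, t x y = t y x
  idem : ∀ x, t x x = x
  cancel : ∀ x y, t x (t x y) = y

/-- The triple through `x` and `y`. -/
def line {X : Type*} [DecidableEq X] (t : X → X → X) (x y : X) : Finset X := {x, y, t x y}

/-- The three points occur in this cyclic order. -/
def Cyc {X : Type*} [LinearOrder X] (x y z : X) : Prop :=
  (x < y ∧ y < z) ∨ (y < z ∧ z < x) ∨ (z < x ∧ x < y)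

/-- The orientation of all triples prescribed by `f`: a triple is directed along the cyclic order
of its points if `f` is true there, and against it otherwise. -/
def orient {X : Type*} [LinearOrder X] (t : X → X → X) (f : Finset X → Bool) : Digraph X where
  Adj x y := x ≠ y ∧ (f (line t x y) = true ↔ Cyc x y (t x y))

section Steiner

variable {X : Type*} {t : X → X → X}

theorem IsSteinerQuasigroup.ne_left (ht : IsSteinerQuasigroup t) {x y : X} (h : x ≠ y) :
    t x y ≠ x := fun e => h (by rw [← ht.cancel x y, e, ht.idem])

theorem IsSteinerQuasigroup.ne_right (ht : IsSteinerQuasigroup t) {x y : X} (h : x ≠ y) :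
    t x y ≠ y := by rw [ht.comm]; exact ht.ne_left h.symm

theorem IsSteinerQuasigroup.cancel_right (ht : IsSteinerQuasigroup t) (x y : X) :
    t y (t x y) = x := by rw [ht.comm x y, ht.cancel]

variable [LinearOrder X]

theorem line_comm (ht : IsSteinerQuasigroup t) (x y : X) : line t x y = line t y x := by
  simp only [line, ht.comm y x, Finset.insert_comm]

theorem line_rotate (ht : IsSteinerQuasigroup t) (x y : X) :
    line t y (t x y) = line t x y := by
  ext z
  simp only [line, ht.cancel_right, Finset.mem_insert, Finset.mem_singleton]
  tauto

theorem line_eq_of_mem (ht : IsSteinerQuasigroup t) {x y a b : X} (hab : a ≠ b)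
    (ha : a ∈ line t x y) (hb : b ∈ line t x y) : line t a b = line t x y := by
  have h1 := line_rotate ht x y
  have h2 := line_rotate ht y x
  rw [line_comm ht y x, ht.comm y x] at h2
  have h3 := line_comm ht
  simp only [line, Finset.mem_insert, Finset.mem_singleton] at ha hb
  rcases ha with rfl | rfl | rfl <;> rcases hb with rfl | rfl | rfl <;> grind

theorem Cyc.rotate_iff {x y z : X} : Cyc y z x ↔ Cyc x y z := by
  unfold Cyc; tauto

theorem cyc_swap_iff {x y z : X} (hxy : x ≠ y) (hyz : y ≠ z) (hzx : z ≠ x) :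
    Cyc y x z ↔ ¬ Cyc x y z := by
  unfold Cyc
  rcases hxy.lt_or_gt with h1 | h1 <;> rcases hyz.lt_or_gt with h2 | h2 <;>
    rcases hzx.lt_or_gt with h3 | h3 <;>
    simp [h1, h2, h3, h1.not_gt, h2.not_gt, h3.not_gt]

/-- Rotation preserves both the triple and the cyclic order of its points, while a swap reverses the
order; hence `orient` makes every triple a directed 3-cycle. -/
theorem orient_rotate (ht : IsSteinerQuasigroup t) (f : Finset X → Bool) {x y : X} (h : x ≠ y) :
    (orient t f).Adj y (t x y) ↔ (orient t f).Adj x y := by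
  simp only [orient, line_rotate ht, ht.cancel_right, Cyc.rotate_iff, h, (ht.ne_right h).symm, ne_eq,
    not_false_eq_true, true_and]

theorem orient_swap (ht : IsSteinerQuasigroup t) (f : Finset X → Bool) {x y : X} (h : x ≠ y) :
    (orient t f).Adj y x ↔ ¬ (orient t f).Adj x y := by
  simp only [orient, line_comm ht y x, ht.comm y x, h, h.symm, ne_eq, not_false_eq_true, true_and,
    cyc_swap_iff h (ht.ne_right h).symm (ht.ne_left h)]
  tauto

theorem isOriented_orient (ht : IsSteinerQuasigroup t) (f : Finset X → Bool) :
    IsOriented (orient t f) :=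
  ⟨fun _ h => h.1 rfl, fun _ _ h => by rw [orient_swap ht f h.1]; exact not_not.2 h⟩

/-- The Steiner triple system of a Steiner quasigroup. -/
def IsSteinerQuasigroup.toSystem (ht : IsSteinerQuasigroup t) : SteinerTripleSystem X where
  triples := {B | ∃ x y, x ≠ y ∧ B = line t x y}
  card_eq_three := by
    rintro B ⟨x, y, h, rfl⟩
    exact Finset.card_eq_three.2 ⟨x, y, t x y, h, (ht.ne_left h).symm, (ht.ne_right h).symm, rfl⟩
  unique_triple x y h := by
    refine ⟨line t x y, ⟨⟨x, y, h, rfl⟩, by simp [line], by simp [line]⟩, ?_⟩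
    rintro B ⟨⟨a, b, -, rfl⟩, hx, hy⟩
    exact (line_eq_of_mem ht h hx hy).symm

theorem isSteinerTripleGraph_orient (ht : IsSteinerQuasigroup t) (f : Finset X → Bool) :
    IsSteinerTripleGraph (orient t f) := by
  refine ⟨ht.toSystem, isOriented_orient ht f, ?_⟩
  have main : ∀ x y, (orient t f).Adj x y → ∃ a b c : X, a ≠ b ∧ b ≠ c ∧ c ≠ a ∧
      (∀ z, z ∈ line t x y ↔ z = a ∨ z = b ∨ z = c) ∧ (orient t f).Adj a b ∧
      (orient t f).Adj b c ∧ (orient t f).Adj c a := by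
    intro x y hxy
    have h := hxy.1
    have h2 := (orient_rotate ht f h).2 hxy
    have h3 := (orient_rotate ht f h2.1).2 h2
    rw [ht.cancel_right] at h3
    exact ⟨x, y, t x y, h, h2.1, h3.1, fun z => by simp [line], hxy, h2, h3⟩
  rintro B ⟨x, y, h, rfl⟩
  by_cases hxy : (orient t f).Adj x y
  · exact main x y hxy
  · rw [line_comm ht]
    exact main y x ((orient_swap ht f h).2 hxy)

end Steiner

/-! ### Counting orientations -/

open Finset in
/-- Functions `L → Bool` that match none of the patterns `τ j` on disjoint blocks `B j` of size at
most `s` are few. -/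
theorem card_avoid_patterns_le {L ι : Type*} [Fintype L] [DecidableEq L] [DecidableEq ι]
    (s : ℕ) (U : Finset ι) (B : ι → Finset L) (τ : ι → L → Bool)
    (hB : ∀ j ∈ U, #(B j) ≤ s) (hd : ∀ i ∈ U, ∀ j ∈ U, i ≠ j → Disjoint (B i) (B j)) :
    (#{f : L → Bool | ∀ j ∈ U, ∃ l ∈ B j, f l ≠ τ j l} : ℝ) ≤
      (1 - (1 / 2) ^ s) ^ #U * Fintype.card (L → Bool) := by
  induction U using Finset.induction_on with
  | empty => simp
  | insert a U ha ih =>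
    specialize ih (fun j hj => hB j (mem_insert_of_mem hj))
      (fun i hi j hj => hd i (mem_insert_of_mem hi) j (mem_insert_of_mem hj))
    set A : Finset (L → Bool) := {f | ∀ j ∈ U, ∃ l ∈ B j, f l ≠ τ j l} with hA
    let M : Finset (L → Bool) := {f ∈ A | ∀ l ∈ B a, f l = τ a l}
    have hsplit : #M + #{f : L → Bool | ∀ j ∈ insert a U, ∃ l ∈ B j, f l ≠ τ j l} = #A := by
      rw [← card_filter_add_card_filter_not (s := A) (fun f => ∀ l ∈ B a, f l = τ a l)]
      congr 2
      ext f
      simp only [hA, mem_filter, mem_univ, true_and, mem_insert, forall_eq_or_imp, not_forall,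
        exists_prop, ne_eq]
      tauto
    have hM : #A ≤ 2 ^ s * #M := by
      -- Overwriting `f` on `B a` by `τ a` lands in `M`, since the other blocks are disjoint from `B
      -- a`. The erased values, at most `2 ^ s` choices, recover `f`.
      let φ : (L → Bool) → (L → Bool) × (B a → Bool) :=
        fun f => (fun l => if l ∈ B a then τ a l else f l, fun l => f l)
      have hφ : Function.Injective φ := by
        intro f g hfg
        ext1 l
        have h1 := congrFun (congrArg Prod.fst hfg) l
        by_cases hl : l ∈ B a
        · exact congrFun (congrArg Prod.snd hfg) ⟨l, hl⟩
        · simpa [φ, hl] using h1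
      have hmaps : ∀ f ∈ A, φ f ∈ M ×ˢ (univ : Finset (B a → Bool)) := by
        intro f hf
        simp only [hA, mem_filter, mem_univ, true_and] at hf
        simp only [φ, M, hA, mem_product, mem_filter, mem_univ, true_and, and_true]
        refine ⟨fun j hj => ?_, fun l hl => if_pos hl⟩
        obtain ⟨l, hl, hne⟩ := hf j hj
        have hla : l ∉ B a := Finset.disjoint_left.1
          (hd j (mem_insert_of_mem hj) a (mem_insert_self _ _) (by rintro rfl; exact ha hj)) hl
        exact ⟨l, hl, by simpa [hla] using hne⟩
      calc #A ≤ #(M ×ˢ (univ : Finset (B a → Bool))) := card_le_card_of_injOn φ hmaps hφ.injOn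
        _ = 2 ^ #(B a) * #M := by simp [card_product, mul_comm]
        _ ≤ 2 ^ s * #M := by
          gcongr
          · norm_num
          · exact hB a (mem_insert_self _ _)
    rw [card_insert_of_notMem ha, pow_succ]
    have h1 : (#M : ℝ) + #{f : L → Bool | ∀ j ∈ insert a U, ∃ l ∈ B j, f l ≠ τ j l} = #A := by
      exact_mod_cast hsplit
    have h2 : (#A : ℝ) ≤ 2 ^ s * #M := by exact_mod_cast hM
    have h3 : (1 / 2 : ℝ) ^ s * #A ≤ #M := by
      rw [one_div, inv_pow, inv_mul_le_iff₀ (by positivity)]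
      exact h2
    have h4 : (0 : ℝ) ≤ 1 - (1 / 2) ^ s :=
      sub_nonneg.2 (pow_le_one₀ (by norm_num) (by norm_num))
    calc _ ≤ (1 - (1 / 2) ^ s) * (#A : ℝ) := by linarith
      _ ≤ (1 - (1 / 2) ^ s) * ((1 - (1 / 2) ^ s) ^ #U * Fintype.card (L → Bool)) :=
          mul_le_mul_of_nonneg_left ih h4
      _ = _ := by ring

open Finset in
/-- Many points that lie on no triple through two points of `D`, and no two of which lie on a
common triple with a point of `D`. -/
theorem exists_scattered {X : Type*} [Fintype X] [DecidableEq X] {t : X → X → X}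
    (ht : IsSteinerQuasigroup t) (D : Finset X) (s N : ℕ) (hD : #D ≤ s)
    (hN : s ^ 2 + N * s + N ≤ Fintype.card X) :
    ∃ U : Finset X, #U = N ∧ (∀ u ∈ U, ∀ c ∈ D, ∀ c' ∈ D, u ≠ t c c') ∧
      ∀ u ∈ U, ∀ u' ∈ U, u ≠ u' → ∀ c ∈ D, u' ≠ t u c := by
  induction N with
  | zero => exact ⟨∅, by simp⟩
  | succ N ih =>
    obtain ⟨U, hU, h1, h2⟩ := ih (by nlinarith)
    -- Greedy choice: a new point need only avoid `W`. The middle set handles both orders of a pair,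
    -- as `u = t w c` iff `w = t u c`.
    let W := (D ×ˢ D).image (fun p => t p.1 p.2) ∪ (U ×ˢ D).image (fun p => t p.1 p.2) ∪ U
    have hW : #W < Fintype.card X := by
      have e1 : #W ≤ #D * #D + #U * #D + #U := by
        refine (card_union_le _ _).trans (Nat.add_le_add_right
          ((card_union_le _ _).trans (Nat.add_le_add ?_ ?_)) _)
        · exact card_image_le.trans (card_product _ _).le
        · exact card_image_le.trans (card_product _ _).le
      have e2 : #D * #D ≤ s * s := Nat.mul_le_mul hD hD
      have e3 : #U * #D ≤ N * s := Nat.mul_le_mul hU.le hD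
      nlinarith
    obtain ⟨w, hw⟩ : ∃ w, w ∉ W := by
      by_contra! hcon
      exact hW.ne (by rw [eq_univ_of_forall hcon, card_univ])
    simp only [W, mem_union, mem_image, mem_product, Prod.exists, not_or, not_exists, not_and,
      and_imp] at hw
    obtain ⟨⟨hw1, hw2⟩, hw3⟩ := hw
    refine ⟨insert w U, by rw [card_insert_of_notMem hw3, hU], ?_, ?_⟩
    · simp only [mem_insert, forall_eq_or_imp]
      exact ⟨fun c hc c' hc' h => hw1 c c' hc hc' h.symm, h1⟩
    · simp only [mem_insert, forall_eq_or_imp, ne_eq, not_true_eq_false, false_implies, true_and]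
      refine ⟨fun u hu _ c hc h => hw2 u c hu hc ?_, fun u hu => ⟨fun _ c hc h =>
        hw2 u c hu hc h.symm, h2 u hu⟩⟩
      rw [h, ht.comm, ht.cancel_right]

section Random

open Finset

variable {X : Type*} [Fintype X] [LinearOrder X] {t : X → X → X}

open Classical in
/-- For a given position of the robber and of `m` cops, few orientations leave the robber without
a safe move. -/
theorem card_no_escape_le (ht : IsSteinerQuasigroup t) (m N : ℕ)
    (hN : (m + 1) ^ 2 + N * (m + 1) + N ≤ Fintype.card X) (v : X) (g : Fin m → X) :
    (#{f : Finset X → Bool | ¬ ∃ u, (orient t f).Adj v u ∧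
        ∀ i, g i ≠ v → (orient t f).Adj u (g i)} : ℝ) ≤
      (1 - (1 / 2) ^ (m + 1)) ^ N * Fintype.card (Finset X → Bool) := by
  -- Including `v` makes the arc from `v` to `u` one of the at most `m + 1` constraints.
  let D : Finset X := insert v (univ.image g)
  have hD : #D ≤ m + 1 := (card_insert_le _ _).trans
    (Nat.add_le_add_right (card_image_le.trans (by simp)) _)
  obtain ⟨U, rfl, h1, h2⟩ := exists_scattered ht D (m + 1) N hD hN
  have hUD : ∀ u ∈ U, u ∉ D := fun u hu hc => h1 u hu u hc u hc (ht.idem u).symm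
  have hinj : ∀ u ∈ U, ∀ c ∈ D, ∀ c' ∈ D, line t u c = line t u c' → c = c' := by
    intro u hu c hc c' hc' h
    have hmem : c' ∈ line t u c := by rw [h]; simp [line]
    simp only [line, mem_insert, mem_singleton] at hmem
    rcases hmem with rfl | rfl | rfl
    · exact absurd hc' (hUD _ hu)
    · rfl
    · exact absurd (ht.cancel_right u c).symm (h1 u hu c hc _ hc')
  -- The value `f` must take on the triple through `u` and `c`: the arc enters `u` if `c = v` and
  -- leaves `u` otherwise. By `hinj` these demands never conflict.
  let w : X → X → Prop := fun u c =>
    if c = v then Cyc v u (t v u) else Cyc u c (t u c)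
  let τ : X → Finset X → Bool := fun u l => decide (∃ c ∈ D, l = line t u c ∧ w u c)
  have hτ : ∀ u ∈ U, ∀ c ∈ D, (τ u (line t u c) = true ↔ w u c) := by
    intro u hu c hc
    simp only [τ, decide_eq_true_eq]
    refine ⟨?_, fun h => ⟨c, hc, rfl, h⟩⟩
    rintro ⟨c', hc', h, hw⟩
    rwa [hinj u hu c hc c' hc' h]
  refine le_trans ?_ (card_avoid_patterns_le (m + 1) U (fun u => D.image (line t u)) τ
    (fun u _ => card_image_le.trans hD) ?_)
  · refine Nat.cast_le.2 (card_le_card fun f hf => ?_)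
    simp only [mem_filter, mem_univ, true_and] at hf ⊢
    intro u hu
    by_contra! hcon
    have hf' : ∀ c ∈ D, (f (line t u c) = true ↔ w u c) := fun c hc => by
      rw [hcon _ (mem_image_of_mem _ hc), hτ u hu c hc]
    have hne : ∀ c ∈ D, u ≠ c := fun c hc e => hUD u hu (e ▸ hc)
    refine hf ⟨u, ⟨(hne v (mem_insert_self _ _)).symm, ?_⟩, fun i hi => ?_⟩
    · rw [line_comm ht, hf' v (mem_insert_self _ _)]
      simp [w]
    · have hgi : g i ∈ D := mem_insert_of_mem (mem_image_of_mem _ (mem_univ i))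
      refine ⟨hne _ hgi, ?_⟩
      rw [hf' _ hgi]
      simp [w, hi]
  · intro u hu u' hu' hne
    simp only [Finset.disjoint_left, mem_image, not_exists, not_and]
    rintro _ ⟨c, hc, rfl⟩ c' hc' h
    have hmem : u' ∈ line t u c := by rw [← h]; simp [line]
    simp only [line, mem_insert, mem_singleton] at hmem
    rcases hmem with rfl | rfl | h
    · exact hne rfl
    · exact hUD _ hu' hc
    · exact h2 u hu u' hu' hne c hc h

/-- Union bound over the `card X ^ (m + 1)` positions of robber and cops. -/
theorem exists_evasive_orient (ht : IsSteinerQuasigroup t) (m N : ℕ)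
    (hN : (m + 1) ^ 2 + N * (m + 1) + N ≤ Fintype.card X)
    (hlt : (Fintype.card X : ℝ) ^ (m + 1) * (1 - (1 / 2) ^ (m + 1)) ^ N < 1) :
    ∃ f : Finset X → Bool, Evasive (orient t f).Adj m := by
  classical
  by_contra! hcon
  let bad : X × (Fin m → X) → Finset (Finset X → Bool) := fun p =>
    {f | ¬ ∃ u, (orient t f).Adj p.1 u ∧ ∀ i, p.2 i ≠ p.1 → (orient t f).Adj u (p.2 i)}
  have hcover : (univ : Finset (Finset X → Bool)) ⊆ univ.biUnion bad := by
    intro f _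
    have := hcon f
    simp only [Evasive, not_forall] at this
    obtain ⟨v, g, h⟩ := this
    exact mem_biUnion.2 ⟨(v, g), mem_univ _, by simpa [bad] using h⟩
  have h1 : (Fintype.card (Finset X → Bool) : ℝ) ≤ ∑ p, (#(bad p) : ℝ) := by
    exact_mod_cast (card_le_card hcover).trans card_biUnion_le
  have h2 : ∑ p, (#(bad p) : ℝ) ≤ ∑ _p : X × (Fin m → X),
      (1 - (1 / 2 : ℝ) ^ (m + 1)) ^ N * Fintype.card (Finset X → Bool) :=
    sum_le_sum fun p _ => card_no_escape_le ht m N hN p.1 p.2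
  rw [sum_const, card_univ, nsmul_eq_mul, Fintype.card_prod, Fintype.card_fun, Fintype.card_fin,
    ← pow_succ', Nat.cast_pow, ← mul_assoc] at h2
  have h3 : (0 : ℝ) < Fintype.card (Finset X → Bool) := by exact_mod_cast Fintype.card_pos
  nlinarith

end Random

/-! ### Steiner triple graphs of large cop number -/

theorem exists_isSteinerQuasigroup (d : ℕ) :
    ∃ t : Fin (3 ^ d) → Fin (3 ^ d) → Fin (3 ^ d), IsSteinerQuasigroup t := by
  obtain ⟨e⟩ : Nonempty (Fin (3 ^ d) ≃ (Fin d → ZMod 3)) :=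
    ⟨(Fintype.equivFinOfCardEq (by simp)).symm⟩
  have h3 : ∀ x : ZMod 3, -(x + x) = x := by decide
  refine ⟨fun x y => e.symm (-(e x + e y)), fun x y => ?_, fun x => ?_, fun x y => ?_⟩
  · simp only [add_comm]
  · rw [Equiv.symm_apply_eq]
    exact funext fun i => h3 _
  · simp

-- Since `3 ^ d ≤ (2 ^ d) ^ 2`, the number of positions is polynomial in `N = 2 ^ d`, while the
-- failure bound decays exponentially in `N`; and `(3 / 2) ^ d` outgrows `s ^ 2 + s + 1`, leaving
-- room for `N` candidates.
open Filter Topology in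
theorem exists_dimension (s : ℕ) : ∃ d : ℕ, s ^ 2 + 2 ^ d * s + 2 ^ d ≤ 3 ^ d ∧
    ((3 ^ d : ℕ) : ℝ) ^ s * (1 - (1 / 2) ^ s) ^ (2 ^ d) < 1 := by
  have hr0 : (0 : ℝ) ≤ 1 - (1 / 2) ^ s :=
    sub_nonneg.2 (pow_le_one₀ (by norm_num) (by norm_num))
  have hr1 : (1 : ℝ) - (1 / 2) ^ s < 1 := sub_lt_self _ (by positivity)
  have h1 := (tendsto_pow_const_mul_const_pow_of_lt_one (2 * s) hr0 hr1).comp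
    (tendsto_pow_atTop_atTop_of_one_lt (r := 2) (by norm_num))
  have h2 := tendsto_pow_atTop_atTop_of_one_lt (r := (3 / 2 : ℝ)) (by norm_num)
  obtain ⟨d, hd1, hd2⟩ := ((h1.eventually_lt_const one_pos).and
    (h2.eventually_ge_atTop ((s : ℝ) ^ 2 + s + 1))).exists
  refine ⟨d, ?_, lt_of_le_of_lt (mul_le_mul_of_nonneg_right ?_ (pow_nonneg hr0 _)) hd1⟩
  · rw [div_pow, le_div_iff₀ (by positivity)] at hd2
    have h3 : (s ^ 2 + s + 1) * 2 ^ d ≤ 3 ^ d := by exact_mod_cast hd2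
    have h4 : 1 ≤ 2 ^ d := Nat.one_le_two_pow
    nlinarith [Nat.mul_le_mul_left (s ^ 2) h4]
  · rw [pow_mul]
    gcongr
    have : 3 ^ d ≤ (2 ^ d) ^ 2 := by
      rw [← pow_mul, mul_comm, pow_mul]
      exact Nat.pow_le_pow_left (by norm_num) d
    exact_mod_cast this

theorem exists_isSteinerTripleGraph_lt_digraphCop (m : ℕ) : ∃ (n : ℕ) (T : Digraph (Fin n)),
    IsSteinerTripleGraph T ∧ m < digraphCop T := by
  obtain ⟨d, hd, hlt⟩ := exists_dimension (m + 1)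
  obtain ⟨t, ht⟩ := exists_isSteinerQuasigroup d
  obtain ⟨f, hf⟩ := exists_evasive_orient ht m (2 ^ d) (by simpa using hd) (by simpa using hlt)
  refine ⟨3 ^ d, orient t f, isSteinerTripleGraph_orient ht f,
    hf.lt_digraphCop (isOriented_orient ht f) ?_⟩
  rw [Nat.card_eq_fintype_card, Fintype.card_fin]
  nlinarith [Nat.zero_le (2 ^ d * (m + 1)), Nat.zero_le (2 ^ d)]

theorem digraphCop_of_isEmpty {V : Type*} [IsEmpty V] (D : Digraph V) : digraphCop D = 0 :=
  Nat.le_zero.1 (Nat.sInf_le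
    ⟨⟨fun _ i => i.elim0, fun _ _ i => i.elim0⟩, fun r _ => isEmptyElim (r 0)⟩)

end CopsRobbers

theorem mainTheorem11 :
    (∀ k : ℕ, ∃ (n : ℕ) (T : Digraph (Fin n)),
      CopsRobbers.IsSteinerTripleGraph T ∧ k ≤ CopsRobbers.digraphCop T) ∧
    (∀ (n : ℕ) (T : Digraph (Fin n)), 1 ≤ n → CopsRobbers.IsSteinerTripleGraph T →
      CopsRobbers.underlying T = ⊤ ∧ CopsRobbers.graphCop (CopsRobbers.underlying T) = 1) ∧
    (∀ k : ℕ, ∃ (n : ℕ) (D : Digraph (Fin n)),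
      CopsRobbers.IsOriented D ∧ CopsRobbers.StronglyConnected D ∧
      CopsRobbers.underlying D = ⊤ ∧
      (CopsRobbers.digraphCop D : ℤ) - (CopsRobbers.graphCop (CopsRobbers.underlying D) : ℤ) >
        (k : ℤ)) := by
  have key : ∀ (n : ℕ) (T : Digraph (Fin n)), 1 ≤ n → CopsRobbers.IsSteinerTripleGraph T →
      CopsRobbers.underlying T = ⊤ ∧ CopsRobbers.graphCop (CopsRobbers.underlying T) = 1 := by
    intro n T hn hT
    have : Nonempty (Fin n) := ⟨⟨0, hn⟩⟩
    exact ⟨hT.underlying_eq_top, by rw [hT.underlying_eq_top, CopsRobbers.graphCop_top]⟩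
  refine ⟨fun k => ?_, key, fun k => ?_⟩
  · obtain ⟨n, T, hT, h⟩ := CopsRobbers.exists_isSteinerTripleGraph_lt_digraphCop k
    exact ⟨n, T, hT, h.le⟩
  -- The extra one pays for the subtracted cop number `1`.
  · obtain ⟨n, T, hT, h⟩ := CopsRobbers.exists_isSteinerTripleGraph_lt_digraphCop (k + 1)
    have hn : 1 ≤ n := by
      rcases Nat.eq_zero_or_pos n with rfl | hn
      · rw [CopsRobbers.digraphCop_of_isEmpty] at h
        omega
      · exact hn
    obtain ⟨htop, hcop⟩ := key n T hn hT
    refine ⟨n, T, ?_, hT.stronglyConnected, htop, ?_⟩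
    · obtain ⟨S, hS⟩ := hT
      exact hS.1
    · rw [hcop]
      omega
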